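/- There is a universal constant $C>0$ such that the following holds for all integers $n,d_x,d_y\ge 1$ and $r\ge 0$, all $\sigma>0$ and $\delta\in(0,1)$, and every matrix $A\in\mathbb{R}^{d_y\times d_x}$ with $\operatorname{rank}(A)\le r$. Let $Y=XA^\top+E$, where $X\in\mathbb{R}^{n\times d_x}$ is a random matrix of covariates (its rows are $x_1^\top,\dots,x_n^\top$) and $E\in\mathbb{R}^{n\times d_y}$ is independent of $X$ with i.i.d. $\mathcal{N}(0,\sigma^2)$ entries. Let $\hat\Sigma=\frac1n X^\top X$, let $\lambda_{\min}(\hat\Sigma),\lambda_{\max}(\hat\Sigma)$ be its extreme eigenvalues and $\kappa(\hat\Sigma)=\lambda_{\max}(\hat\Sigma)/\lambda_{\min}(\hat\Sigma)$. Put $$\mu=10\,\sigma\sqrt{\lambda_{\max}(\hat\Sigma)}\left(\sqrt{\tfrac{d_x+d_y}{n}}+\sqrt{\tfrac{\log(1/(2\delta))}{2n}}\right),\qquad \xi=\frac{2\mu}{\lambda_{\min}(\hat\Sigma)},$$ where the square root of a negative number (the last root when $\delta>1/2$) is read as $0$. Let $\bar A$ be (almost surely) a minimizer over $B\in\mathbb{R}^{d_y\times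 d_x}$ of $$\Vert Y-XB^\top\Vert_{\mathrm F}^2+\mu\Vert B\Vert_1,$$ where $\Vert\cdot\Vert_1$ is the nuclear norm (the sum of the singular values). Let $\hat A_n=\bar A(\xi)$ be obtained from $\bar A$ by keeping, in its singular value decomposition, only the singular values that are at least $\xi$. Then, with probability at least $1-\delta$, $$\Vert\hat A_n-A\Vert_{\mathrm F}^2\le C\min_{0\le k\le r}\left[k\,\sigma^2\,\kappa(\hat\Sigma)\,\frac{d_x+d_y+\log(1/\delta)}{n\,\lambda_{\min}(\hat\Sigma)}+\sum_{i>k}s_i(A)^2\right],$$ where $s_1(A)\ge s_2(A)\ge\cdots$ are the singular values of $A$, and the inequality is understood to hold (its right-hand side being $+\infty$) whenever $\hat\Sigma$ is singular. -/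

import Mathlib

open MeasureTheory ProbabilityTheory

noncomputable section

namespace NuclearThreshold

/-- The singular values of a real matrix in decreasing order, with multiplicity.
The index starts at `0`, so `sv A i` is the singular value `s_{i+1}(A)`;
it vanishes for `i ≥ min p q`. -/
def sv {p q : ℕ} (A : Matrix (Fin p) (Fin q) ℝ) (i : ℕ) : ℝ :=
  (Matrix.toEuclideanLin A).singularValues i

/-- The nuclear norm: the sum of the singular values. -/
def nuclearNorm {p q : ℕ} (A : Matrix (Fin p) (Fin q) ℝ) : ℝ :=
  ∑ i ∈ Finset.range (min p q), sv A i

/-- The squared Frobenius norm. -/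
def frobSq {p q : ℕ} (A : Matrix (Fin p) (Fin q) ℝ) : ℝ :=
  ∑ i, ∑ j, A i j ^ 2

/-- An orthonormal basis of right singular vectors of `A` (eigenvectors of `Aᵀ A`), ordered by
decreasing singular value. -/
def rightSingularBasis {p q : ℕ} (A : Matrix (Fin p) (Fin q) ℝ) :
    OrthonormalBasis (Fin q) ℝ (EuclideanSpace ℝ (Fin q)) :=
  (Matrix.toEuclideanLin A).isSymmetric_adjoint_comp_self.eigenvectorBasis
    finrank_euclideanSpace_fin

/-- The rank-`k` truncation `Π_k(A) = ∑_{i ≤ k} s_i u_i v_iᵀ` of the singular value decomposition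
of `A`, written as `∑_{i ≤ k} (A v_i) v_iᵀ`. -/
def truncate {p q : ℕ} (k : ℕ) (A : Matrix (Fin p) (Fin q) ℝ) : Matrix (Fin p) (Fin q) ℝ :=
  ∑ i : Fin q with i.val < k,
    Matrix.vecMulVec (A.mulVec (rightSingularBasis A i).ofLp) (rightSingularBasis A i).ofLp

/-- The number of singular values of `A` that are at least `ξ`. -/
def effectiveRank {p q : ℕ} (ξ : ℝ) (A : Matrix (Fin p) (Fin q) ℝ) : ℕ :=
  ((Finset.range (min p q)).filter (fun i => ξ ≤ sv A i)).card

/-- Hard thresholding `A(ξ)` of the singular values of `A` at level `ξ`. -/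
def threshold {p q : ℕ} (ξ : ℝ) (A : Matrix (Fin p) (Fin q) ℝ) : Matrix (Fin p) (Fin q) ℝ :=
  truncate (effectiveRank ξ A) A

/-- The empirical covariance matrix `n⁻¹ Xᵀ X` of the rows of `X`. -/
def empCov {n p : ℕ} (X : Matrix (Fin n) (Fin p) ℝ) : Matrix (Fin p) (Fin p) ℝ :=
  (n : ℝ)⁻¹ • (X.transpose * X)

theorem empCov_isHermitian {n p : ℕ} (X : Matrix (Fin n) (Fin p) ℝ) :
    (empCov X).IsHermitian := by
  unfold Matrix.IsHermitian empCov
  simp [Matrix.conjTranspose_eq_transpose_of_trivial]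

/-- The smallest eigenvalue of the empirical covariance. -/
def lamMin {n p : ℕ} (X : Matrix (Fin n) (Fin p) ℝ) : ℝ :=
  ⨅ i, (empCov_isHermitian X).eigenvalues i

/-- The largest eigenvalue of the empirical covariance. -/
def lamMax {n p : ℕ} (X : Matrix (Fin n) (Fin p) ℝ) : ℝ :=
  ⨆ i, (empCov_isHermitian X).eigenvalues i

/-- The condition number of the empirical covariance. -/
def condNum {n p : ℕ} (X : Matrix (Fin n) (Fin p) ℝ) : ℝ :=
  lamMax X / lamMin X

/-- The regularization parameter; `Real.sqrt` of a negative number is `0`, which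
concerns the last root for `δ > 1/2`. -/
def regParam {n p : ℕ} (q : ℕ) (σ δ : ℝ) (X : Matrix (Fin n) (Fin p) ℝ) : ℝ :=
  10 * σ * √(lamMax X) *
    (√(((p : ℝ) + (q : ℝ)) / (n : ℝ)) + √(Real.log (1 / (2 * δ)) / (2 * (n : ℝ))))

/-- The threshold level. -/
def thresholdLevel {n p : ℕ} (q : ℕ) (σ δ : ℝ) (X : Matrix (Fin n) (Fin p) ℝ) : ℝ :=
  20 * σ * √(lamMax X) *
    (√(((p : ℝ) + (q : ℝ)) / (n : ℝ)) + √(Real.log (1 / (2 * δ)) / (2 * (n : ℝ)))) / lamMin X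

/-- `Abar` minimizes `B ↦ ‖Y - X Bᵀ‖_F² + μ ‖B‖_*` over all `q × p` matrices `B`. -/
def IsNuclearNormEstimator {n p q : ℕ} (μ : ℝ) (X : Matrix (Fin n) (Fin p) ℝ)
    (Y : Matrix (Fin n) (Fin q) ℝ) (Abar : Matrix (Fin q) (Fin p) ℝ) : Prop :=
  ∀ B : Matrix (Fin q) (Fin p) ℝ,
    frobSq (Y - X * Abar.transpose) + μ * nuclearNorm Abar ≤
      frobSq (Y - X * B.transpose) + μ * nuclearNorm B

/-- The quantity `min_{0 ≤ k ≤ r} [k σ² κ (p + q + log(1/δ)) / (n λ_min) + ∑_{i > k} s_i(A)²]`. -/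
def oracleRisk {n p q : ℕ} (r : ℕ) (σ δ : ℝ) (X : Matrix (Fin n) (Fin p) ℝ)
    (A : Matrix (Fin q) (Fin p) ℝ) : ℝ :=
  (Finset.range (r + 1)).inf' Finset.nonempty_range_add_one fun k =>
    (k : ℝ) * σ ^ 2 * condNum X *
        (((p : ℝ) + (q : ℝ) + Real.log (1 / δ)) / ((n : ℝ) * lamMin X)) +
      ∑ i ∈ Finset.Ico k (min q p), sv A i ^ 2

end NuclearThreshold

end

/-! The proof separates a deterministic argument from a single probabilistic event.

Deterministic part: moving the minimizer `M` along rank-one directions `v uᵀ` raises the nuclear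
norm by at most `‖v‖‖u‖`, so optimality bounds `⟨X u, (Y - X Mᵀ) v⟩` by `μ/2 · ‖u‖‖v‖`. If the noise
form `⟨X u, E v⟩` is at most `n μ/2 · ‖u‖‖v‖`, the choice `u = (A - M)ᵀ v` yields `‖M - A‖ ≤ μ/λ_min
= ξ/2` in operator norm (`IsNuclearNormEstimator.norm_sub_le`). Thresholding at twice the
operator-norm error is then oracle-optimal: by Weyl's inequality each of the first `k` directions
costs `O(ξ²)` and each later one `O(s_j(A)²)`, for every `k` at once
(`sum_norm_sq_threshold_sub_le`). Finally `ξ²` is at most 800 times the per-rank term of the oracle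
risk.

Probabilistic part: for fixed `X`, `u`, `v` the noise form is Gaussian with standard deviation `σ‖X
u‖‖v‖`. Independence lets `X` be frozen, and a union bound over `1/4`-nets of the two unit balls,
with at most `9^(p+q)` pairs, makes the bound uniform (`measure_exists_lt_dotProduct_le`). -/

/-! ### Variational bounds for singular values. -/

namespace LinearMap

open Module

variable {E F : Type*} [NormedAddCommGroup E] [InnerProductSpace ℝ E] [FiniteDimensional ℝ E]
  [NormedAddCommGroup F] [InnerProductSpace ℝ F] [FiniteDimensional ℝ F]

theorem inner_apply_eigenvectorBasis (T : E →ₗ[ℝ] F) {n : ℕ} (hn : finrank ℝ E = n)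
    (i j : Fin n) :
    inner ℝ (T (T.isSymmetric_adjoint_comp_self.eigenvectorBasis hn i))
      (T (T.isSymmetric_adjoint_comp_self.eigenvectorBasis hn j)) =
      if i = j then T.singularValues i ^ 2 else 0 := by
  rw [← LinearMap.adjoint_inner_right, ← LinearMap.comp_apply,
    IsSymmetric.apply_eigenvectorBasis, inner_smul_right,
    orthonormal_iff_ite.1 (OrthonormalBasis.orthonormal _), sq_singularValues_fin T hn]
  split_ifs with h <;> simp [h]

theorem norm_apply_eigenvectorBasis (T : E →ₗ[ℝ] F) {n : ℕ} (hn : finrank ℝ E = n) (i : Fin n) :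
    ‖T (T.isSymmetric_adjoint_comp_self.eigenvectorBasis hn i)‖ = T.singularValues i := by
  have h := T.inner_apply_eigenvectorBasis hn i i
  rw [real_inner_self_eq_norm_sq, if_pos rfl] at h
  exact (pow_left_inj₀ (norm_nonneg _) (T.singularValues_nonneg _) two_ne_zero).1 h

theorem norm_sq_apply_eq_sum (T : E →ₗ[ℝ] F) {n : ℕ} (hn : finrank ℝ E = n) (x : E) :
    ‖T x‖ ^ 2 = ∑ i : Fin n, T.singularValues i ^ 2 *
      inner ℝ (T.isSymmetric_adjoint_comp_self.eigenvectorBasis hn i) x ^ 2 := by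
  set b := T.isSymmetric_adjoint_comp_self.eigenvectorBasis hn with hb
  conv_lhs => rw [← b.sum_repr' x, map_sum]
  rw [← real_inner_self_eq_norm_sq, sum_inner]
  refine Finset.sum_congr rfl fun i _ => ?_
  simp only [inner_sum, map_smul, inner_smul_left, inner_smul_right]
  simp only [hb, T.inner_apply_eigenvectorBasis hn]
  simp
  ring

/-- The hard half of the Courant–Fischer principle. -/
theorem le_singularValues_of_forall_mem (T : E →ₗ[ℝ] F) (V : Submodule ℝ E) {i : ℕ}
    (hi : i < finrank ℝ V) {c : ℝ} (hc : ∀ x ∈ V, c * ‖x‖ ≤ ‖T x‖) : c ≤ T.singularValues i := by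
  set b := T.isSymmetric_adjoint_comp_self.eigenvectorBasis rfl with hb
  have hiE : i < finrank ℝ E := hi.trans_le V.finrank_le
  let φ : V →ₗ[ℝ] (Fin i → ℝ) :=
    LinearMap.pi fun j => (innerₛₗ ℝ (b ⟨j, j.2.trans hiE⟩)).comp V.subtype
  -- A space of dimension greater than `i` contains a nonzero vector orthogonal to the top `i`
  -- singular directions; there `T` stretches by at most the singular value of index `i`.
  have hker : LinearMap.ker φ ≠ ⊥ := LinearMap.ker_ne_bot_of_finrank_lt (by simpa using hi)
  obtain ⟨x, hx, hx0⟩ := Submodule.exists_mem_ne_zero_of_ne_bot hker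
  have hxb : ∀ j : Fin (finrank ℝ E), j.val < i → inner ℝ (b j) (x : E) = 0 := fun j hj =>
    congrFun (LinearMap.mem_ker.1 hx) ⟨j, hj⟩
  have hle : ‖T x‖ ^ 2 ≤ (T.singularValues i * ‖(x : E)‖) ^ 2 := by
    rw [mul_pow, ← b.sum_sq_norm_inner_right, Finset.mul_sum, T.norm_sq_apply_eq_sum rfl]
    refine Finset.sum_le_sum fun j _ => ?_
    rw [← hb]
    by_cases hj : j.val < i
    · simp [hxb j hj]
    · rw [Real.norm_eq_abs, sq_abs]
      have := T.singularValues_antitone (not_lt.1 hj)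
      have := T.singularValues_nonneg j
      gcongr
  have hx' : 0 < ‖(x : E)‖ := by simpa using hx0
  have h1 := abs_le_of_sq_le_sq hle (mul_nonneg (T.singularValues_nonneg _) (norm_nonneg _))
  exact le_of_mul_le_mul_right ((hc x x.2).trans ((le_abs_self _).trans h1)) hx'

/-- The easy half of the Courant–Fischer principle. -/
theorem exists_submodule_singularValues_mul_norm_le (T : E →ₗ[ℝ] F) {i : ℕ}
    (hi : i < finrank ℝ E) :
    ∃ V : Submodule ℝ E, finrank ℝ V = i + 1 ∧ ∀ x ∈ V, T.singularValues i * ‖x‖ ≤ ‖T x‖ := by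
  set b := T.isSymmetric_adjoint_comp_self.eigenvectorBasis rfl with hb
  let f : Fin (i + 1) → E := fun j => b (Fin.castLE hi j)
  have hf : LinearIndependent ℝ f :=
    b.orthonormal.linearIndependent.comp _ (Fin.castLE_injective hi)
  refine ⟨Submodule.span ℝ (Set.range f), by simp [finrank_span_eq_card hf], fun x hx => ?_⟩
  have hxb : ∀ j : Fin (finrank ℝ E), i < j.val → inner ℝ (b j) x = 0 := by
    intro j hj
    induction hx using Submodule.span_induction with
    | mem y hy =>
      obtain ⟨k, rfl⟩ := hy
      refine b.orthonormal.2 fun h => ?_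
      have := congrArg Fin.val h
      have := k.2
      simp at *
      omega
    | zero => simp
    | add y z _ _ hy hz => rw [inner_add_right, hy, hz, add_zero]
    | smul a y _ hy => rw [inner_smul_right, hy, mul_zero]
  refine le_of_sq_le_sq ?_ (norm_nonneg _)
  rw [mul_pow, ← b.sum_sq_norm_inner_right, Finset.mul_sum, T.norm_sq_apply_eq_sum rfl]
  refine Finset.sum_le_sum fun j _ => ?_
  rw [← hb]
  by_cases hj : i < j.val
  · simp [hxb j hj]
  · rw [Real.norm_eq_abs, sq_abs]
    have := T.singularValues_antitone (not_lt.1 hj)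
    have := T.singularValues_nonneg i
    gcongr

/-- Weyl's perturbation inequality for singular values. -/
theorem singularValues_le_add (T S : E →ₗ[ℝ] F) {c : ℝ} (hc : ∀ x, ‖T x - S x‖ ≤ c * ‖x‖) {i : ℕ}
    (hi : i < finrank ℝ E) : T.singularValues i ≤ S.singularValues i + c := by
  obtain ⟨V, hV, hVT⟩ := T.exists_submodule_singularValues_mul_norm_le hi
  rw [← sub_le_iff_le_add]
  refine S.le_singularValues_of_forall_mem V (by omega) fun x hx => ?_
  have h1 := hVT x hx
  have h2 := hc x
  have h3 := norm_sub_norm_le (T x) (S x)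
  linarith [sub_mul (T.singularValues i) c ‖x‖]

theorem singularValues_le_of_norm_le (T : E →ₗ[ℝ] F) {c : ℝ} (hc : ∀ x, ‖T x‖ ≤ c * ‖x‖) {i : ℕ}
    (hi : i < finrank ℝ E) : T.singularValues i ≤ c := by
  simpa using T.singularValues_le_add 0 (by simpa using hc) hi

/-- If `T ∘ P` stretches a subspace `V` by at least `s > 0`, then `P` is injective on `V`, and `T`
stretches the equidimensional `P(V)` by at least `s` because `P` is a contraction. -/
theorem singularValues_comp_le (T : E →ₗ[ℝ] F) (P : E →ₗ[ℝ] E) (hP : ∀ x, ‖P x‖ ≤ ‖x‖) (i : ℕ) :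
    (T ∘ₗ P).singularValues i ≤ T.singularValues i := by
  rcases le_or_gt (finrank ℝ E) i with hi | hi
  · rw [singularValues_of_finrank_le _ hi]
    exact T.singularValues_nonneg i
  rcases ((T ∘ₗ P).singularValues_nonneg i).eq_or_lt with h0 | h0
  · rw [← h0]
    exact T.singularValues_nonneg i
  obtain ⟨V, hV, hVT⟩ := (T ∘ₗ P).exists_submodule_singularValues_mul_norm_le hi
  have hinj : Function.Injective (P.domRestrict V) := by
    rw [← LinearMap.ker_eq_bot, LinearMap.ker_eq_bot']
    intro x hx
    have hx' : P x = 0 := hx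
    have h := hVT x x.2
    rw [LinearMap.comp_apply, hx', map_zero, norm_zero] at h
    have : ‖(x : E)‖ ≤ 0 := by
      by_contra! hpos
      nlinarith
    simpa using this
  have hfin : finrank ℝ (V.map P) = i + 1 := by
    rw [← LinearMap.range_domRestrict, LinearMap.finrank_range_of_inj hinj, hV]
  refine T.le_singularValues_of_forall_mem (V.map P) (by omega) ?_
  rintro _ ⟨x, hx, rfl⟩
  exact (mul_le_mul_of_nonneg_left (hP x) h0.le).trans (hVT x hx)

/-- Left singular vectors. Since `0⁻¹ = 0`, the vectors belonging to zero singular values are zero;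
norm at most one is all that is used later, so no completion to an orthonormal family is needed. -/
theorem exists_orthogonal_inner_apply_eq_singularValues (T : E →ₗ[ℝ] F) {n : ℕ}
    (hn : finrank ℝ E = n) :
    ∃ w : Fin n → F, (∀ i j, i ≠ j → inner ℝ (w i) (w j) = 0) ∧ (∀ i, ‖w i‖ ≤ 1) ∧
      ∀ i, T (T.isSymmetric_adjoint_comp_self.eigenvectorBasis hn i) =
        T.singularValues i • w i ∧
      inner ℝ (w i) (T (T.isSymmetric_adjoint_comp_self.eigenvectorBasis hn i)) =
        T.singularValues i := by
  refine ⟨fun i => (T.singularValues i)⁻¹ •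
    T (T.isSymmetric_adjoint_comp_self.eigenvectorBasis hn i), fun i j hij => ?_, fun i => ?_,
    fun i => ⟨?_, ?_⟩⟩
  · rw [inner_smul_left, inner_smul_right, T.inner_apply_eigenvectorBasis hn, if_neg hij]
    simp
  · rw [norm_smul, T.norm_apply_eigenvectorBasis hn, Real.norm_eq_abs,
      abs_of_nonneg (inv_nonneg.2 (T.singularValues_nonneg _))]
    exact inv_mul_le_one
  · rcases eq_or_ne (T.singularValues i) 0 with h | h
    · rw [h, zero_smul, ← norm_eq_zero, T.norm_apply_eigenvectorBasis hn, h]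
    · rw [smul_smul, mul_inv_cancel₀ h, one_smul]
  · rw [inner_smul_left, T.inner_apply_eigenvectorBasis hn, if_pos rfl]
    rcases eq_or_ne (T.singularValues i) 0 with h | h
    · simp [h]
    · simp only [conj_trivial]
      field_simp

end LinearMap

/-! ### Rank-one perturbations and the sum of singular values. -/

theorem sum_sq_inner_le_of_orthogonal {ι F : Type*} [Fintype ι] [NormedAddCommGroup F]
    [InnerProductSpace ℝ F] (w : ι → F) (hw : ∀ i j, i ≠ j → inner ℝ (w i) (w j) = 0)
    (hw1 : ∀ i, ‖w i‖ ≤ 1) (v : F) : ∑ i, inner ℝ (w i) v ^ 2 ≤ ‖v‖ ^ 2 := by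
  set x := ∑ i, inner ℝ (w i) v • w i with hx
  set s := ∑ i, inner ℝ (w i) v ^ 2 with hs
  have hxv : inner ℝ x v = s := by
    simp [hx, hs, sum_inner, inner_smul_left, sq]
  have hxx : ‖x‖ ^ 2 ≤ s := by
    rw [← real_inner_self_eq_norm_sq]
    conv_lhs => rw [hx]
    rw [sum_inner]
    refine Finset.sum_le_sum fun i _ => ?_
    rw [inner_smul_left, inner_sum, Finset.sum_eq_single i]
    · rw [inner_smul_right, real_inner_self_eq_norm_sq]
      have : ‖w i‖ ^ 2 ≤ 1 := pow_le_one₀ (norm_nonneg _) (hw1 i)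
      simp only [conj_trivial]
      nlinarith [sq_nonneg (inner ℝ (w i) v)]
    · intro j _ hj
      rw [inner_smul_right, hw i j hj.symm, mul_zero]
    · simp
  have := sq_nonneg ‖x - v‖
  rw [norm_sub_sq_real, hxv] at this
  nlinarith

/-- Cauchy–Schwarz, then Bessel for `w` and Parseval for `b`. It plays the role of the duality
between nuclear and operator norm. -/
theorem sum_inner_mul_inner_le {ι E F : Type*} [Fintype ι] [NormedAddCommGroup E]
    [InnerProductSpace ℝ E] [NormedAddCommGroup F] [InnerProductSpace ℝ F]
    (b : OrthonormalBasis ι ℝ E) (w : ι → F) (hw : ∀ i j, i ≠ j → inner ℝ (w i) (w j) = 0)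
    (hw1 : ∀ i, ‖w i‖ ≤ 1) (u : E) (v : F) :
    ∑ i, inner ℝ (w i) v * inner ℝ (b i) u ≤ ‖v‖ * ‖u‖ := by
  refine le_of_sq_le_sq ?_ (by positivity)
  refine (Finset.sum_mul_sq_le_sq_mul_sq _ _ _).trans ?_
  rw [mul_pow]
  refine mul_le_mul (sum_sq_inner_le_of_orthogonal w hw hw1 v) ?_
    (Finset.sum_nonneg fun i _ => sq_nonneg _) (sq_nonneg _)
  rw [← b.sum_sq_norm_inner_right]
  simp

/-- Adding a rank-one map increases the sum of the singular values by at most its norm. -/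
theorem LinearMap.sum_singularValues_le_of_apply_eq {E F : Type*} [NormedAddCommGroup E]
    [InnerProductSpace ℝ E] [FiniteDimensional ℝ E] [NormedAddCommGroup F]
    [InnerProductSpace ℝ F] [FiniteDimensional ℝ F] (T S : E →ₗ[ℝ] F) {n : ℕ}
    (hn : Module.finrank ℝ E = n) (u : E) (v : F) (hS : ∀ x, S x = T x + inner ℝ u x • v) :
    ∑ i : Fin n, S.singularValues i ≤ ∑ i : Fin n, T.singularValues i + ‖v‖ * ‖u‖ := by
  obtain ⟨w, hw, hw1, hwS⟩ := S.exists_orthogonal_inner_apply_eq_singularValues hn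
  obtain ⟨z, -, hz1, hzT⟩ := T.exists_orthogonal_inner_apply_eq_singularValues hn
  set b := S.isSymmetric_adjoint_comp_self.eigenvectorBasis hn
  set d := T.isSymmetric_adjoint_comp_self.eigenvectorBasis hn
  -- Write each singular value of `S` as `⟨w i, S (b i)⟩` and expand `T` in its own singular basis.
  -- After exchanging the sums, the coefficient of each singular value of `T` is at most one.
  have h1 : ∀ i : Fin n, S.singularValues i =
      ∑ k : Fin n, T.singularValues k * (inner ℝ (w i) (z k) * inner ℝ (b i) (d k)) +
        inner ℝ (w i) v * inner ℝ (b i) u := by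
    intro i
    rw [← (hwS i).2, hS, inner_add_right, inner_smul_right, real_inner_comm u (b i)]
    congr 1
    · conv_lhs => rw [← d.sum_repr' (b i), map_sum, inner_sum]
      refine Finset.sum_congr rfl fun k _ => ?_
      rw [map_smul, (hzT k).1, inner_smul_right, inner_smul_right, real_inner_comm (d k)]
      ring
    · ring
  simp only [h1, Finset.sum_add_distrib]
  refine add_le_add ?_ (sum_inner_mul_inner_le b w hw hw1 u v)
  rw [Finset.sum_comm]
  refine Finset.sum_le_sum fun k _ => ?_
  rw [← Finset.mul_sum]
  have h2 := sum_inner_mul_inner_le b w hw hw1 (d k) (z k)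
  rw [d.norm_eq_one, mul_one] at h2
  exact mul_le_of_le_one_right (T.singularValues_nonneg _) (h2.trans (hz1 k))

/-! ### Hard thresholding under an operator-norm perturbation. -/

namespace LinearMap

open Module

section TailProj

variable {E : Type*} [NormedAddCommGroup E] [InnerProductSpace ℝ E]

/-- The projection onto the span of the basis vectors with index at least `m`. -/
noncomputable def tailProj {n : ℕ} (b : OrthonormalBasis (Fin n) ℝ E) (m : ℕ) : E →ₗ[ℝ] E :=
  b.toBasis.constr ℝ fun j => if j.val < m then 0 else b j

theorem tailProj_basis {n : ℕ} (b : OrthonormalBasis (Fin n) ℝ E) (m : ℕ) (j : Fin n) :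
    tailProj b m (b j) = if j.val < m then 0 else b j := by
  have h := b.toBasis.constr_basis ℝ (fun j : Fin n => if j.val < m then (0 : E) else b j) j
  rwa [b.coe_toBasis] at h

theorem inner_tailProj {n : ℕ} (b : OrthonormalBasis (Fin n) ℝ E) (m : ℕ) (j : Fin n) (x : E) :
    inner ℝ (b j) (tailProj b m x) = if j.val < m then 0 else inner ℝ (b j) x := by
  conv_lhs => rw [← b.sum_repr' x, map_sum, inner_sum]
  simp only [map_smul, tailProj_basis, inner_smul_right, apply_ite (inner ℝ (b j)), inner_zero_right,
    orthonormal_iff_ite.1 b.orthonormal]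
  rw [Finset.sum_eq_single j] <;> simp +contextual [eq_comm]

theorem norm_tailProj_le {n : ℕ} (b : OrthonormalBasis (Fin n) ℝ E) (m : ℕ) (x : E) :
    ‖tailProj b m x‖ ≤ ‖x‖ := by
  refine le_of_sq_le_sq ?_ (norm_nonneg _)
  rw [← b.sum_sq_norm_inner_right, ← b.sum_sq_norm_inner_right]
  refine Finset.sum_le_sum fun j _ => ?_
  rw [inner_tailProj]
  split_ifs <;> simp [sq_nonneg]

end TailProj

variable {E F : Type*} [NormedAddCommGroup E] [InnerProductSpace ℝ E] [FiniteDimensional ℝ E]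
  [NormedAddCommGroup F] [InnerProductSpace ℝ F] [FiniteDimensional ℝ F]

/-- Both sides sum the squared matrix entries. The right side does not involve `b`, whence the
Hilbert–Schmidt sum is independent of the basis. -/
theorem sum_norm_sq_apply_eq_sum_adjoint {ι : Type*} [Fintype ι] (T : E →ₗ[ℝ] F)
    (b : OrthonormalBasis ι ℝ E) :
    ∑ i, ‖T (b i)‖ ^ 2 = ∑ l, ‖T.adjoint (stdOrthonormalBasis ℝ F l)‖ ^ 2 := by
  have h1 : ∀ i, ‖T (b i)‖ ^ 2 = ∑ l, ‖inner ℝ (stdOrthonormalBasis ℝ F l) (T (b i))‖ ^ 2 :=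
    fun i => ((stdOrthonormalBasis ℝ F).sum_sq_norm_inner_right _).symm
  have h2 : ∀ y, ‖T.adjoint y‖ ^ 2 = ∑ i, ‖inner ℝ (b i) (T.adjoint y)‖ ^ 2 :=
    fun y => (b.sum_sq_norm_inner_right _).symm
  simp only [h1, h2, LinearMap.adjoint_inner_right]
  rw [Finset.sum_comm]
  refine Finset.sum_congr rfl fun l _ => Finset.sum_congr rfl fun i _ => ?_
  rw [norm_inner_symm]

theorem sum_norm_sq_apply_eq {ι κ : Type*} [Fintype ι] [Fintype κ] (T : E →ₗ[ℝ] F)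
    (b : OrthonormalBasis ι ℝ E) (d : OrthonormalBasis κ ℝ E) :
    ∑ i, ‖T (b i)‖ ^ 2 = ∑ j, ‖T (d j)‖ ^ 2 := by
  rw [T.sum_norm_sq_apply_eq_sum_adjoint b, T.sum_norm_sq_apply_eq_sum_adjoint d]

theorem sum_norm_sq_apply_eq_sum_singularValues {ι : Type*} [Fintype ι] (T : E →ₗ[ℝ] F)
    (b : OrthonormalBasis ι ℝ E) {n : ℕ} (hn : finrank ℝ E = n) :
    ∑ i, ‖T (b i)‖ ^ 2 = ∑ i : Fin n, T.singularValues i ^ 2 := by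
  rw [T.sum_norm_sq_apply_eq b (T.isSymmetric_adjoint_comp_self.eigenvectorBasis hn)]
  simp only [T.norm_apply_eigenvectorBasis hn]

theorem norm_apply_tailProj_le (M : E →ₗ[ℝ] F) {n : ℕ} (hn : finrank ℝ E = n) {m : ℕ} {ξ : ℝ}
    (hξ : 0 ≤ ξ) (hM : ∀ i, m ≤ i → M.singularValues i ≤ ξ) (x : E) :
    ‖M (tailProj (M.isSymmetric_adjoint_comp_self.eigenvectorBasis hn) m x)‖ ≤ ξ * ‖x‖ := by
  set b := M.isSymmetric_adjoint_comp_self.eigenvectorBasis hn with hb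
  refine le_of_sq_le_sq ?_ (by positivity)
  rw [mul_pow, M.norm_sq_apply_eq_sum hn, ← hb, ← b.sum_sq_norm_inner_right x, Finset.mul_sum]
  refine Finset.sum_le_sum fun j _ => ?_
  rw [inner_tailProj]
  split_ifs with h
  · rw [zero_pow two_ne_zero, mul_zero]
    positivity
  · rw [Real.norm_eq_abs, sq_abs]
    have := hM j (not_lt.1 h)
    have := M.singularValues_nonneg j
    gcongr

/-- Hard thresholding of the singular values of a perturbation `M` of `A` attains, up to a
constant, the error of the best low-rank approximation. -/
theorem sum_norm_sq_threshold_sub_le (M A : E →ₗ[ℝ] F) {n : ℕ} (hn : finrank ℝ E = n) {m : ℕ}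
    {ξ : ℝ} (hξ : 0 ≤ ξ) (hMA : ∀ x, ‖M x - A x‖ ≤ ξ / 2 * ‖x‖)
    (hlt : ∀ i, i < m → ξ ≤ M.singularValues i) (hge : ∀ i, m ≤ i → M.singularValues i ≤ ξ)
    (k : ℕ) :
    ∑ j : Fin n, ‖(if j.val < m then M (M.isSymmetric_adjoint_comp_self.eigenvectorBasis hn j)
        else 0) - A (M.isSymmetric_adjoint_comp_self.eigenvectorBasis hn j)‖ ^ 2 ≤
      5 / 2 * ∑ j : Fin n, (if j.val < k then ξ ^ 2 else A.singularValues j ^ 2) := by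
  set b := M.isSymmetric_adjoint_comp_self.eigenvectorBasis hn with hb
  set N := A ∘ₗ tailProj b m with hN
  -- The tail of `M` has norm at most `ξ`, and replacing `M` by `A` adds `ξ / 2`.
  have hNle : ∀ x, ‖N x‖ ≤ 3 / 2 * ξ * ‖x‖ := by
    intro x
    have h1 := norm_apply_tailProj_le M hn hξ hge x
    rw [← hb] at h1
    have h2 := hMA (tailProj b m x)
    have h3 := mul_le_mul_of_nonneg_left (norm_tailProj_le b m x) (by positivity : 0 ≤ ξ / 2)
    have h4 := norm_sub_norm_le (A (tailProj b m x)) (M (tailProj b m x))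
    rw [norm_sub_rev] at h4
    rw [hN, LinearMap.comp_apply]
    linarith
  have hsplit : ∀ j : Fin n, ‖(if j.val < m then M (b j) else 0) - A (b j)‖ ^ 2 ≤
      (if j.val < m then ξ ^ 2 / 4 else 0) + ‖N (b j)‖ ^ 2 := by
    intro j
    rw [hN, LinearMap.comp_apply, tailProj_basis]
    split_ifs with h
    · have h1 := hMA (b j)
      rw [b.norm_eq_one, mul_one] at h1
      have := pow_le_pow_left₀ (norm_nonneg _) h1 2
      simp only [map_zero, norm_zero]
      linarith [div_pow ξ 2 2]
    · simp
  refine (Finset.sum_le_sum fun j _ => hsplit j).trans ?_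
  rw [Finset.sum_add_distrib, N.sum_norm_sq_apply_eq_sum_singularValues b hn,
    ← Finset.sum_add_distrib, Finset.mul_sum]
  refine Finset.sum_le_sum fun j _ => ?_
  have hj : j.val < finrank ℝ E := hn ▸ j.2
  have hN0 := N.singularValues_nonneg j
  have hN1 := N.singularValues_le_of_norm_le hNle hj
  have hN2 := A.singularValues_comp_le (tailProj b m) (norm_tailProj_le b m) j
  rw [← hN] at hN2
  have hA := M.singularValues_le_add A hMA hj
  have hA0 := A.singularValues_nonneg j
  -- For `j < k`: `ξ²/4 + (3ξ/2)² = (5/2) ξ²`. For `j ≥ k`, the term `ξ²/4` occurs only if `j < m`;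
  -- Weyl then gives `s_j(A) ≥ ξ/2`, so the total is at most `2 s_j(A)²`.
  by_cases hk : j.val < k
  · rw [if_pos hk]
    have := pow_le_pow_left₀ hN0 hN1 2
    split_ifs <;> nlinarith
  · rw [if_neg hk]
    have := pow_le_pow_left₀ hN0 hN2 2
    split_ifs with hm
    · have := hlt j hm
      nlinarith
    · nlinarith

end LinearMap

/-! ### Translation to matrices. -/

namespace NuclearThreshold

open Matrix

variable {p q : ℕ}

theorem frobSq_eq_sum_norm_sq {ι : Type*} [Fintype ι] (A : Matrix (Fin p) (Fin q) ℝ)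
    (b : OrthonormalBasis ι ℝ (EuclideanSpace ℝ (Fin q))) :
    frobSq A = ∑ i, ‖toEuclideanLin A (b i)‖ ^ 2 := by
  rw [LinearMap.sum_norm_sq_apply_eq _ b (EuclideanSpace.basisFun (Fin q) ℝ), frobSq,
    Finset.sum_comm]
  refine Finset.sum_congr rfl fun j _ => ?_
  rw [EuclideanSpace.real_norm_sq_eq]
  simp

theorem sv_antitone (A : Matrix (Fin p) (Fin q) ℝ) : Antitone (sv A) :=
  LinearMap.singularValues_antitone _

theorem sv_eq_zero (A : Matrix (Fin p) (Fin q) ℝ) {i : ℕ} (hi : min p q ≤ i) : sv A i = 0 := by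
  rw [sv, LinearMap.singularValues_eq_zero_iff_le_finrank_range]
  refine le_trans (le_min ?_ ?_) hi
  · exact (Submodule.finrank_le _).trans (by simp)
  · exact (LinearMap.finrank_range_le _).trans (by simp)

theorem sum_range_min_sv (A : Matrix (Fin p) (Fin q) ℝ) (f : ℝ → ℝ) (hf : f 0 = 0) :
    ∑ i ∈ Finset.range (min p q), f (sv A i) = ∑ i : Fin q, f (sv A i) := by
  rw [Fin.sum_univ_eq_sum_range fun i => f (sv A i)]
  refine Finset.sum_subset (Finset.range_mono (min_le_right p q)) fun i _ hi => ?_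
  rw [sv_eq_zero A (not_lt.1 fun h => hi (Finset.mem_range.2 h)), hf]

theorem nuclearNorm_eq_sum_fin (A : Matrix (Fin p) (Fin q) ℝ) :
    nuclearNorm A = ∑ i : Fin q, (toEuclideanLin A).singularValues i :=
  sum_range_min_sv A id rfl

theorem nuclearNorm_add_vecMulVec_le (A : Matrix (Fin p) (Fin q) ℝ)
    (v : EuclideanSpace ℝ (Fin p)) (u : EuclideanSpace ℝ (Fin q)) :
    nuclearNorm (A + vecMulVec v.ofLp u.ofLp) ≤ nuclearNorm A + ‖v‖ * ‖u‖ := by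
  rw [nuclearNorm_eq_sum_fin, nuclearNorm_eq_sum_fin]
  refine LinearMap.sum_singularValues_le_of_apply_eq _ _ (by simp) u v fun x => ?_
  rw [map_add, LinearMap.add_apply]
  congr 1
  ext i
  simp [toLpLin_apply, vecMulVec_mulVec, EuclideanSpace.inner_eq_star_dotProduct, dotProduct_comm]

/-- The counted indices form an initial segment because singular values decrease, so truncating at
their number is thresholding. -/
theorem lt_effectiveRank_iff {ξ : ℝ} (A : Matrix (Fin p) (Fin q) ℝ) (i : ℕ) :
    i < effectiveRank ξ A ↔ i < min p q ∧ ξ ≤ sv A i := by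
  set S := (Finset.range (min p q)).filter (fun i => ξ ≤ sv A i) with hS
  have hmem : ∀ j, j ∈ S ↔ j < min p q ∧ ξ ≤ sv A j := by simp [hS]
  rw [← hmem]
  change i < S.card ↔ i ∈ S
  constructor
  · intro hi
    by_contra hiS
    have : S ⊆ Finset.range i := fun j hj => by
      rw [Finset.mem_range]
      by_contra! hij
      rw [hmem] at hj hiS
      exact hiS ⟨hij.trans_lt hj.1, hj.2.trans (sv_antitone A hij)⟩
    simpa using hi.trans_le (Finset.card_le_card this)
  · intro hi
    have : Finset.range (i + 1) ⊆ S := fun j hj => by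
      rw [Finset.mem_range] at hj
      rw [hmem] at hi ⊢
      exact ⟨by omega, hi.2.trans (sv_antitone A (by omega))⟩
    simpa using Finset.card_le_card this

theorem toEuclideanLin_truncate_apply (k : ℕ) (A : Matrix (Fin p) (Fin q) ℝ) (j : Fin q) :
    toEuclideanLin (truncate k A) (rightSingularBasis A j) =
      if j.val < k then toEuclideanLin A (rightSingularBasis A j) else 0 := by
  set b := rightSingularBasis A
  have h : ∀ i, toEuclideanLin (vecMulVec (A.mulVec (b i).ofLp) (b i).ofLp) (b j) =
      if i = j then toEuclideanLin A (b j) else 0 := by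
    intro i
    have h1 := orthonormal_iff_ite.1 b.orthonormal i j
    rw [EuclideanSpace.inner_eq_star_dotProduct, dotProduct_comm] at h1
    simp only [star_trivial] at h1
    rw [toLpLin_apply, vecMulVec_mulVec, h1]
    split_ifs with hij
    · subst hij
      ext; simp
    · ext; simp
  rw [truncate, map_sum, LinearMap.sum_apply]
  simp only [b, h] at *
  simp

theorem frobSq_threshold_sub_le (M A : Matrix (Fin p) (Fin q) ℝ) {ξ : ℝ} (hξ : 0 ≤ ξ)
    (hMA : ∀ x, ‖toEuclideanLin M x - toEuclideanLin A x‖ ≤ ξ / 2 * ‖x‖) (k : ℕ) :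
    frobSq (threshold ξ M - A) ≤
      5 / 2 * (k * ξ ^ 2 + ∑ i ∈ Finset.Ico k (min p q), sv A i ^ 2) := by
  rw [frobSq_eq_sum_norm_sq _ (rightSingularBasis M)]
  simp only [map_sub, LinearMap.sub_apply, threshold, toEuclideanLin_truncate_apply]
  refine (LinearMap.sum_norm_sq_threshold_sub_le (toEuclideanLin M) (toEuclideanLin A)
    (by simp) hξ hMA (fun i hi => ((lt_effectiveRank_iff M i).1 hi).2) (fun i hi => ?_) k).trans ?_
  · by_contra! h
    have h0 := fun h' => not_lt.2 hi ((lt_effectiveRank_iff M i).2 ⟨h', h.le⟩)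
    have := sv_eq_zero M (not_lt.1 h0)
    rw [sv] at this
    linarith
  · gcongr
    rw [Fin.sum_univ_eq_sum_range (fun j => if j < k then ξ ^ 2 else
      (toEuclideanLin A).singularValues j ^ 2), Finset.sum_ite, Finset.sum_const, nsmul_eq_mul]
    gcongr
    · refine (Finset.card_le_card (t := Finset.range k) fun i hi => ?_).trans_eq (by simp)
      simp at hi ⊢
      exact hi.2
    · refine (Finset.sum_subset (fun i hi => ?_) fun i hi h0 => ?_).ge
      · simp at hi ⊢
        omega
      · simp at hi h0
        rw [← sv, sv_eq_zero A (by omega), zero_pow two_ne_zero]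

end NuclearThreshold

/-! ### Rayleigh quotient bounds for the empirical covariance. -/

namespace Matrix.IsHermitian

variable {ι : Type*} [Fintype ι] [DecidableEq ι] {S : Matrix ι ι ℝ}

theorem dotProduct_mulVec_eq_sum (hS : S.IsHermitian) (u : EuclideanSpace ℝ ι) :
    u.ofLp ⬝ᵥ S.mulVec u.ofLp =
      ∑ i, hS.eigenvalues i * inner ℝ (hS.eigenvectorBasis i) u ^ 2 := by
  set b := hS.eigenvectorBasis
  have hSu : S.mulVec u.ofLp = ∑ i, inner ℝ (b i) u • hS.eigenvalues i • (b i).ofLp := by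
    conv_lhs => rw [← b.sum_repr' u, WithLp.ofLp_sum, Matrix.mulVec_sum]
    refine Finset.sum_congr rfl fun i _ => ?_
    rw [WithLp.ofLp_smul, Matrix.mulVec_smul, hS.mulVec_eigenvectorBasis]
  rw [hSu, dotProduct_sum]
  refine Finset.sum_congr rfl fun i _ => ?_
  have h : u.ofLp ⬝ᵥ (b i).ofLp = inner ℝ (b i) u := by
    simp [EuclideanSpace.inner_eq_star_dotProduct]
  rw [dotProduct_smul, dotProduct_smul, h]
  simp only [smul_eq_mul]
  ring

theorem iInf_eigenvalues_mul_le (hS : S.IsHermitian) (u : EuclideanSpace ℝ ι) :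
    (⨅ i, hS.eigenvalues i) * ‖u‖ ^ 2 ≤ u.ofLp ⬝ᵥ S.mulVec u.ofLp := by
  rw [hS.dotProduct_mulVec_eq_sum, ← hS.eigenvectorBasis.sum_sq_norm_inner_right, Finset.mul_sum]
  refine Finset.sum_le_sum fun i _ => ?_
  rw [Real.norm_eq_abs, sq_abs]
  exact mul_le_mul_of_nonneg_right (ciInf_le (Set.finite_range _).bddBelow i) (sq_nonneg _)

theorem le_iSup_eigenvalues_mul (hS : S.IsHermitian) (u : EuclideanSpace ℝ ι) :
    u.ofLp ⬝ᵥ S.mulVec u.ofLp ≤ (⨆ i, hS.eigenvalues i) * ‖u‖ ^ 2 := by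
  rw [hS.dotProduct_mulVec_eq_sum, ← hS.eigenvectorBasis.sum_sq_norm_inner_right, Finset.mul_sum]
  refine Finset.sum_le_sum fun i _ => ?_
  rw [Real.norm_eq_abs, sq_abs]
  exact mul_le_mul_of_nonneg_right (le_ciSup (Set.finite_range _).bddAbove i) (sq_nonneg _)

end Matrix.IsHermitian

namespace NuclearThreshold

open Matrix

variable {n p q : ℕ}

theorem dotProduct_empCov_mulVec (hn : 0 < n) (X : Matrix (Fin n) (Fin p) ℝ) (u : Fin p → ℝ) :
    n * (u ⬝ᵥ (empCov X).mulVec u) = X.mulVec u ⬝ᵥ X.mulVec u := by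
  rw [empCov, smul_mulVec, dotProduct_smul, ← mulVec_mulVec, dotProduct_mulVec, vecMul_transpose,
    smul_eq_mul, mul_inv_cancel_left₀ (by positivity)]

theorem lamMin_mul_le (hn : 0 < n) (X : Matrix (Fin n) (Fin p) ℝ)
    (u : EuclideanSpace ℝ (Fin p)) :
    n * (lamMin X * ‖u‖ ^ 2) ≤ X.mulVec u.ofLp ⬝ᵥ X.mulVec u.ofLp := by
  rw [← dotProduct_empCov_mulVec hn]
  gcongr
  exact (empCov_isHermitian X).iInf_eigenvalues_mul_le u

theorem le_lamMax_mul (hn : 0 < n) (X : Matrix (Fin n) (Fin p) ℝ)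
    (u : EuclideanSpace ℝ (Fin p)) :
    X.mulVec u.ofLp ⬝ᵥ X.mulVec u.ofLp ≤ n * (lamMax X * ‖u‖ ^ 2) := by
  rw [← dotProduct_empCov_mulVec hn]
  gcongr
  exact (empCov_isHermitian X).le_iSup_eigenvalues_mul u

theorem lamMin_le_lamMax (hp : 0 < p) (X : Matrix (Fin n) (Fin p) ℝ) : lamMin X ≤ lamMax X :=
  (ciInf_le (Set.finite_range _).bddBelow ⟨0, hp⟩).trans
    (le_ciSup (f := fun i => (empCov_isHermitian X).eigenvalues i)
      (Set.finite_range _).bddAbove ⟨0, hp⟩)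

/-! ### Optimality condition and operator-norm error. -/

theorem frobSq_sub_smul_vecMulVec (R : Matrix (Fin n) (Fin q) ℝ) (s : ℝ) (a : Fin n → ℝ)
    (v : Fin q → ℝ) :
    frobSq (R - s • vecMulVec a v) =
      frobSq R - 2 * s * (a ⬝ᵥ R.mulVec v) + s ^ 2 * ((a ⬝ᵥ a) * (v ⬝ᵥ v)) := by
  have h1 : a ⬝ᵥ R.mulVec v = ∑ i, ∑ j, a i * (R i j * v j) := by
    simp only [dotProduct, mulVec, Finset.mul_sum]
  have h2 : (a ⬝ᵥ a) * (v ⬝ᵥ v) = ∑ i, ∑ j, a i * a i * (v j * v j) := by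
    rw [dotProduct, dotProduct, Finset.sum_mul_sum]
  rw [h1, h2]
  simp only [frobSq, Finset.mul_sum, ← Finset.sum_sub_distrib, ← Finset.sum_add_distrib]
  refine Finset.sum_congr rfl fun i _ => Finset.sum_congr rfl fun j _ => ?_
  rw [Matrix.sub_apply, Matrix.smul_apply, vecMulVec_apply, smul_eq_mul]
  ring

/-- The first-order optimality condition for the nuclear norm estimator. -/
theorem IsNuclearNormEstimator.dotProduct_residual_le {μ : ℝ} (hμ : 0 ≤ μ)
    {X : Matrix (Fin n) (Fin p) ℝ} {Y : Matrix (Fin n) (Fin q) ℝ} {M : Matrix (Fin q) (Fin p) ℝ}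
    (hM : IsNuclearNormEstimator μ X Y M) (u : EuclideanSpace ℝ (Fin p))
    (v : EuclideanSpace ℝ (Fin q)) :
    X.mulVec u.ofLp ⬝ᵥ (Y - X * M.transpose).mulVec v.ofLp ≤ μ / 2 * (‖u‖ * ‖v‖) := by
  set R := Y - X * M.transpose with hR
  set a := X.mulVec u.ofLp with ha
  set K := (a ⬝ᵥ a) * (v.ofLp ⬝ᵥ v.ofLp) with hK
  have hK0 : 0 ≤ K := mul_nonneg (Finset.sum_nonneg fun i _ => mul_self_nonneg _)
    (Finset.sum_nonneg fun i _ => mul_self_nonneg _)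
  -- Compare `M` with `M + s v uᵀ` and divide by `s`; the result follows as `s` tends to zero.
  have hstep : ∀ s : ℝ, 0 < s → 2 * (a ⬝ᵥ R.mulVec v.ofLp) - μ * (‖u‖ * ‖v‖) ≤ s * K := by
    intro s hs
    have h := hM (M + vecMulVec (s • v).ofLp u.ofLp)
    have hres : Y - X * (M + vecMulVec (s • v).ofLp u.ofLp).transpose =
        R - s • vecMulVec a v.ofLp := by
      rw [transpose_add, Matrix.mul_add, hR, transpose_vecMulVec, mul_vecMulVec, WithLp.ofLp_smul,
        vecMulVec_smul, ← ha, sub_add_eq_sub_sub]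
    have hnuc := mul_le_mul_of_nonneg_left (nuclearNorm_add_vecMulVec_le M (s • v) u) hμ
    rw [norm_smul, Real.norm_of_nonneg hs.le] at hnuc
    rw [hres, frobSq_sub_smul_vecMulVec] at h
    refine le_of_mul_le_mul_left ?_ hs
    linarith
  by_contra! hlt
  set d := 2 * (a ⬝ᵥ R.mulVec v.ofLp) - μ * (‖u‖ * ‖v‖) with hd
  have hd0 : 0 < d := by linarith
  -- This step size makes `s * K` at most `d / 2`, contradicting `d ≤ s * K`; the `+ 1` covers `K =
  -- 0`.
  have h := hstep (d / (2 * (K + 1))) (by positivity)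
  have h2 : d / (2 * (K + 1)) * K ≤ d / 2 := by
    rw [div_mul_eq_mul_div, div_le_div_iff₀ (by positivity) two_pos]
    nlinarith
  linarith

/-- If the noise is dominated by the regularization parameter, then the nuclear norm estimator is
close to the truth in operator norm. -/
theorem IsNuclearNormEstimator.norm_sub_le (hn : 0 < n) {μ : ℝ} (hμ : 0 ≤ μ)
    {X : Matrix (Fin n) (Fin p) ℝ} (hX : 0 < lamMin X) {A M : Matrix (Fin q) (Fin p) ℝ}
    {N : Matrix (Fin n) (Fin q) ℝ} (hM : IsNuclearNormEstimator μ X (X * A.transpose + N) M)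
    (hN : ∀ (u : EuclideanSpace ℝ (Fin p)) (v : EuclideanSpace ℝ (Fin q)),
      -(X.mulVec u.ofLp ⬝ᵥ N.mulVec v.ofLp) ≤ n * (μ / 2) * (‖u‖ * ‖v‖))
    (x : EuclideanSpace ℝ (Fin p)) :
    ‖toEuclideanLin M x - toEuclideanLin A x‖ ≤ μ / lamMin X * ‖x‖ := by
  set c := μ / lamMin X with hc
  have hc0 : 0 ≤ c := by positivity
  set D := A - M with hD
  have hadj : ∀ v : EuclideanSpace ℝ (Fin q), ‖toEuclideanLin D.transpose v‖ ≤ c * ‖v‖ := by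
    intro v
    -- With this `u`, the signal term `⟨X u, X Dᵀ v⟩` becomes `‖X u‖²`, at least `n λ_min ‖u‖²`.
    set u := toEuclideanLin D.transpose v with hu
    have hu' : u.ofLp = D.transpose.mulVec v.ofLp := by simp [hu, toLpLin_apply]
    have h1 := hM.dotProduct_residual_le hμ u v
    have hres : X * A.transpose + N - X * M.transpose = X * D.transpose + N := by
      rw [hD, transpose_sub, Matrix.mul_sub]
      abel
    rw [hres, add_mulVec, dotProduct_add, ← mulVec_mulVec, ← hu'] at h1
    have h2 := hN u v
    have h3 := lamMin_mul_le hn X u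
    have hn1 : (1 : ℝ) ≤ n := by exact_mod_cast hn
    -- The loss is not divided by `n`, so the penalty contributes only `μ/2`; enlarging it to `n
    -- μ/2` matches the noise bound.
    have h4 : μ / 2 * (‖u‖ * ‖v‖) ≤ n * (μ / 2) * (‖u‖ * ‖v‖) := by
      gcongr
      exact le_mul_of_one_le_left (by positivity) hn1
    have h5 : n * (lamMin X * ‖u‖ ^ 2) ≤ n * (μ * (‖u‖ * ‖v‖)) := by linarith
    have h6 := le_of_mul_le_mul_left h5 (by linarith)
    rcases (norm_nonneg u).eq_or_lt with h0 | h0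
    · rw [← h0]
      positivity
    · rw [hc, div_mul_eq_mul_div, le_div_iff₀ hX]
      refine le_of_mul_le_mul_right ?_ h0
      linarith
  rw [← LinearMap.sub_apply, ← map_sub, ← neg_sub A M, map_neg, LinearMap.neg_apply, norm_neg, ← hD]
  set y := toEuclideanLin D x with hy
  have h1 : ‖y‖ ^ 2 = inner ℝ (toEuclideanLin D.transpose y) x := by
    rw [← real_inner_self_eq_norm_sq, ← conjTranspose_eq_transpose_of_trivial,
      toEuclideanLin_conjTranspose_eq_adjoint, LinearMap.adjoint_inner_left]
  have h2 := (real_inner_le_norm (toEuclideanLin D.transpose y) x).trans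
    (mul_le_mul_of_nonneg_right (hadj y) (norm_nonneg x))
  rcases (norm_nonneg y).eq_or_lt with h0 | h0
  · rw [← h0]
    positivity
  · refine le_of_mul_le_mul_right ?_ h0
    linarith

end NuclearThreshold

/-! ### Nets of the unit ball and bilinear forms. -/

section Net

open Module Metric

/-- Volume comparison: the disjoint balls of radius `1/8` lie in a ball of radius `9/8`. -/
theorem card_le_nine_pow_of_separated {E : Type*} [NormedAddCommGroup E] [NormedSpace ℝ E]
    [FiniteDimensional ℝ E] (s : Finset E) (hs : ∀ c ∈ s, ‖c‖ ≤ 1)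
    (h : ∀ c ∈ s, ∀ d ∈ s, c ≠ d → 1 / 4 ≤ ‖c - d‖) : s.card ≤ 9 ^ finrank ℝ E := by
  borelize E
  let μ : Measure E := Measure.addHaar
  have hdisj : (s : Set E).Pairwise (Function.onFun Disjoint fun c => ball c (1 / 8)) := by
    intro c hc d hd hcd
    refine ball_disjoint_ball ?_
    rw [dist_eq_norm]
    exact le_trans (by norm_num) (h c hc d hd hcd)
  have hsub : (⋃ c ∈ s, ball c (1 / 8 : ℝ)) ⊆ ball (0 : E) (9 / 8) := by
    refine Set.iUnion₂_subset fun x hx => ball_subset_ball' ?_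
    rw [dist_zero_right]
    linarith [hs x hx]
  have hvol : (s.card : ENNReal) * ENNReal.ofReal ((1 / 8) ^ finrank ℝ E) * μ (ball 0 1) ≤
      ENNReal.ofReal ((9 / 8) ^ finrank ℝ E) * μ (ball 0 1) := by
    rw [← μ.addHaar_ball_of_pos (0 : E) (by norm_num : (0 : ℝ) < 9 / 8)]
    refine le_trans (le_of_eq ?_) (measure_mono hsub)
    rw [measure_biUnion_finset hdisj fun c _ => measurableSet_ball]
    simp only [μ.addHaar_ball_of_pos _ (by norm_num : (0 : ℝ) < 1 / 8), Finset.sum_const,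
      nsmul_eq_mul, mul_assoc]
  have hvol' := (ENNReal.mul_le_mul_iff_left
    (measure_ball_pos μ (0 : E) zero_lt_one).ne' measure_ball_lt_top.ne).1 hvol
  have hreal := ENNReal.toReal_le_of_le_ofReal (by positivity) hvol'
  rw [ENNReal.toReal_mul, ENNReal.toReal_natCast, ENNReal.toReal_ofReal (by positivity),
    div_pow, div_pow, one_pow, mul_one_div,
    div_le_div_iff_of_pos_right (by positivity)] at hreal
  exact_mod_cast hreal

/-- A separated set of maximal cardinality is a net: an uncovered point could be added to it. -/
theorem exists_net_closedBall (E : Type*) [NormedAddCommGroup E] [NormedSpace ℝ E]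
    [FiniteDimensional ℝ E] :
    ∃ s : Finset E, s.card ≤ 9 ^ finrank ℝ E ∧ (∀ c ∈ s, ‖c‖ ≤ 1) ∧
      ∀ x : E, ‖x‖ ≤ 1 → ∃ c ∈ s, ‖x - c‖ ≤ 1 / 4 := by
  classical
  let S : Set ℕ := {m | ∃ s : Finset E, s.card = m ∧ (∀ c ∈ s, ‖c‖ ≤ 1) ∧
    ∀ c ∈ s, ∀ d ∈ s, c ≠ d → 1 / 4 ≤ ‖c - d‖}
  have hbdd : BddAbove S := by
    refine ⟨9 ^ finrank ℝ E, ?_⟩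
    rintro _ ⟨s, rfl, hs, hsep⟩
    exact card_le_nine_pow_of_separated s hs hsep
  obtain ⟨s, hcard, hs, hsep⟩ := Nat.sSup_mem (s := S) ⟨0, ∅, by simp⟩ hbdd
  refine ⟨s, card_le_nine_pow_of_separated s hs hsep, hs, fun x hx => ?_⟩
  by_contra! hfar
  have hxs : x ∉ s := fun h => by
    have := hfar x h
    norm_num at this
  have hmem : (insert x s).card ∈ S := by
    refine ⟨insert x s, rfl, by simpa [hx] using hs, ?_⟩
    simp only [Finset.mem_insert]
    rintro c (rfl | hc) d (rfl | hd) hcd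
    · exact absurd rfl hcd
    · exact (hfar d hd).le
    · rw [norm_sub_rev]
      exact (hfar c hc).le
    · exact hsep c hc d hd hcd
  have hle := le_csSup hbdd hmem
  rw [Finset.card_insert_of_notMem hxs] at hle
  omega

/-- A bilinear form is controlled by its values on a product of nets. -/
theorem LinearMap.apply_le_of_net {E F : Type*} [NormedAddCommGroup E] [NormedSpace ℝ E]
    [FiniteDimensional ℝ E] [NormedAddCommGroup F] [NormedSpace ℝ F] [FiniteDimensional ℝ F]
    (B : E →ₗ[ℝ] F →ₗ[ℝ] ℝ) (hB : Continuous fun x : E × F => B x.1 x.2) (s : Set E) (t : Set F)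
    (hs : ∀ x : E, ‖x‖ ≤ 1 → ∃ c ∈ s, ‖x - c‖ ≤ 1 / 4) (hs1 : ∀ c ∈ s, ‖c‖ ≤ 1)
    (ht : ∀ x : F, ‖x‖ ≤ 1 → ∃ c ∈ t, ‖x - c‖ ≤ 1 / 4) {K : ℝ}
    (hK : ∀ u ∈ s, ∀ v ∈ t, B u v ≤ K) (u : E) (v : F) :
    B u v ≤ 2 * K * (‖u‖ * ‖v‖) := by
  obtain ⟨⟨u₀, v₀⟩, ⟨hu₀, hv₀⟩, hmax⟩ :=
    ((isCompact_closedBall (0 : E) 1).prod (isCompact_closedBall (0 : F) 1)).exists_isMaxOn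
      ⟨(0, 0), by simp⟩ hB.continuousOn
  set m := B u₀ v₀ with hm
  have hle1 : ∀ x y, ‖x‖ ≤ 1 → ‖y‖ ≤ 1 → B x y ≤ m := fun x y hx hy =>
    @hmax (x, y) ⟨by simpa using hx, by simpa using hy⟩
  have hle : ∀ x y, B x y ≤ m * (‖x‖ * ‖y‖) := by
    intro x y
    rcases eq_or_ne x 0 with rfl | hx
    · simp
    rcases eq_or_ne y 0 with rfl | hy
    · simp
    have h := hle1 (‖x‖⁻¹ • x) (‖y‖⁻¹ • y) (norm_smul_inv_norm (𝕜 := ℝ) hx).le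
      (norm_smul_inv_norm (𝕜 := ℝ) hy).le
    rw [map_smul, map_smul, LinearMap.smul_apply, smul_eq_mul, smul_eq_mul, ← mul_assoc,
      ← mul_inv, inv_mul_le_iff₀ (by positivity)] at h
    linarith
  have hm0 : 0 ≤ m := by simpa using hle1 0 0 (by simp) (by simp)
  have hu₀' : ‖u₀‖ ≤ 1 := by simpa using hu₀
  have hv₀' : ‖v₀‖ ≤ 1 := by simpa using hv₀
  obtain ⟨c, hc, hcu⟩ := hs u₀ hu₀'
  obtain ⟨d, hd, hdv⟩ := ht v₀ hv₀'
  -- The first two terms are at most `m/4` each and the last at most `K`, so `m ≤ 2K`.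
  have hsplit : m = B (u₀ - c) v₀ + B c (v₀ - d) + B c d := by
    simp [hm]
  have h1 : B (u₀ - c) v₀ ≤ m * (1 / 4 * 1) := (hle _ _).trans (by gcongr)
  have h2 : B c (v₀ - d) ≤ m * (1 * (1 / 4)) := (hle _ _).trans (by
    have := hs1 c hc
    gcongr)
  have h3 : m ≤ 2 * K := by linarith [hK c hc d hd]
  exact (hle u v).trans (by gcongr)

end Net

/-! ### Gaussian tails conditionally on the design. -/

section Gaussian

open Matrix

variable {Ω : Type*} [MeasurableSpace Ω] {P : Measure Ω}

theorem hasSubgaussianMGF_of_map_eq_gaussianReal {Z : Ω → ℝ} {v : NNReal}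
    (hZ : P.map Z = gaussianReal 0 v) : HasSubgaussianMGF Z v P where
  integrable_exp_mul t := by
    have hZm : AEMeasurable Z P := aemeasurable_of_map_neZero (by rw [hZ]; infer_instance)
    have h := integrable_exp_mul_gaussianReal (μ := 0) (v := v) t
    rw [← hZ] at h
    exact h.comp_aemeasurable hZm
  mgf_le t := by rw [mgf_gaussianReal hZ, zero_mul, zero_add]

theorem hasSubgaussianMGF_const_mul_of_map_eq_gaussianReal {Z : Ω → ℝ} {σ : ℝ}
    (hZ : P.map Z = gaussianReal 0 (σ ^ 2).toNNReal) (r : ℝ) :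
    HasSubgaussianMGF (fun ω => r * Z ω) (r ^ 2 * σ ^ 2).toNNReal P := by
  have h := (hasSubgaussianMGF_of_map_eq_gaussianReal hZ).const_mul r
  rw [Real.toNNReal_mul (sq_nonneg r), Real.toNNReal_of_nonneg (sq_nonneg r)]
  exact h

variable [IsProbabilityMeasure P] {n p q : ℕ} {σ t : ℝ} {E : Ω → Matrix (Fin n) (Fin q) ℝ}

theorem measure_lt_dotProduct_mulVec_le (hσ : 0 < σ) (ht : 0 ≤ t)
    (hlaw : ∀ i j, P.map (fun ω => E ω i j) = gaussianReal 0 (σ ^ 2).toNNReal)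
    (hindep : iIndepFun (fun (ij : Fin n × Fin q) (ω : Ω) => E ω ij.1 ij.2) P)
    (a : Fin n → ℝ) (v : Fin q → ℝ) (hv : v ⬝ᵥ v ≤ 1) :
    P {ω | σ * t * √(a ⬝ᵥ a) < a ⬝ᵥ (E ω).mulVec v} ≤ ENNReal.ofReal (Real.exp (-t ^ 2 / 2)) := by
  have ha0 : 0 ≤ a ⬝ᵥ a := Finset.sum_nonneg fun i _ => mul_self_nonneg _
  have hv0 : 0 ≤ v ⬝ᵥ v := Finset.sum_nonneg fun i _ => mul_self_nonneg _
  -- The variance vanishes here and the sub-Gaussian bound degenerates, but the strict inequality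
  -- makes the event empty.
  have hempty : a = 0 ∨ v = 0 → {ω | σ * t * √(a ⬝ᵥ a) < a ⬝ᵥ (E ω).mulVec v} = ∅ := by
    intro h
    refine Set.eq_empty_of_forall_notMem fun ω hω => ?_
    have h0 : a ⬝ᵥ (E ω).mulVec v = 0 := by rcases h with rfl | rfl <;> simp
    rw [Set.mem_ofPred_eq, h0] at hω
    exact absurd hω (not_lt.2 (by positivity))
  by_cases hav : a = 0 ∨ v = 0
  · simp [hempty hav]
  push Not at hav
  have ha : 0 < a ⬝ᵥ a := ha0.lt_of_ne' fun h => hav.1 (dotProduct_self_eq_zero.1 h)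
  have hvpos : 0 < v ⬝ᵥ v := hv0.lt_of_ne' fun h => hav.2 (dotProduct_self_eq_zero.1 h)
  have hsum : ∀ ω, a ⬝ᵥ (E ω).mulVec v =
      ∑ ij : Fin n × Fin q, a ij.1 * v ij.2 * E ω ij.1 ij.2 := by
    intro ω
    simp only [dotProduct, mulVec, Finset.mul_sum, Fintype.sum_prod_type]
    refine Finset.sum_congr rfl fun i _ => Finset.sum_congr rfl fun j _ => ?_
    ring
  have hsub := HasSubgaussianMGF.sum_of_iIndepFun (s := Finset.univ)
    (hindep.comp (fun ij x => a ij.1 * v ij.2 * x) fun ij => measurable_const_mul _)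
    (fun ij _ => hasSubgaussianMGF_const_mul_of_map_eq_gaussianReal (hlaw ij.1 ij.2)
      (a ij.1 * v ij.2))
  have hbound := hsub.measure_ge_le (ε := σ * t * √(a ⬝ᵥ a)) (by positivity)
  have hvar : ((∑ ij : Fin n × Fin q,
      ((a ij.1 * v ij.2) ^ 2 * σ ^ 2).toNNReal : NNReal) : ℝ) =
      (a ⬝ᵥ a) * (v ⬝ᵥ v) * σ ^ 2 := by
    rw [NNReal.coe_sum, dotProduct, dotProduct, Finset.sum_mul_sum, ← Fintype.sum_prod_type',
      Finset.sum_mul]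
    refine Finset.sum_congr rfl fun ij _ => ?_
    rw [Real.coe_toNNReal _ (by positivity)]
    ring
  rw [hvar] at hbound
  have hexp : -(σ * t * √(a ⬝ᵥ a)) ^ 2 / (2 * ((a ⬝ᵥ a) * (v ⬝ᵥ v) * σ ^ 2)) ≤ -t ^ 2 / 2 := by
    rw [mul_pow, Real.sq_sqrt ha0, neg_div, neg_div, neg_le_neg_iff,
      div_le_div_iff₀ two_pos (by positivity)]
    have : 0 ≤ (a ⬝ᵥ a) * σ ^ 2 * t ^ 2 := by positivity
    nlinarith
  rw [← ofReal_measureReal]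
  refine ENNReal.ofReal_le_ofReal (le_trans ?_ (hbound.trans (Real.exp_le_exp.2 hexp)))
  refine measureReal_mono fun ω hω => ?_
  rw [Set.mem_ofPred_eq, hsum] at hω
  exact hω.le

/-- Fubini: under independence, a bound valid for each frozen value of `f` survives integration over
its law. -/
theorem ProbabilityTheory.IndepFun.measure_mem_le {α β : Type*} [MeasurableSpace α]
    [MeasurableSpace β] {f : Ω → α} {g : Ω → β} (hfg : IndepFun f g P) (hf : Measurable f)
    (hg : Measurable g) {S : Set (α × β)} (hS : MeasurableSet S) {c : ENNReal}
    (hc : ∀ x, P {ω | (x, g ω) ∈ S} ≤ c) : P {ω | (f ω, g ω) ∈ S} ≤ c := by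
  have := Measure.isProbabilityMeasure_map (μ := P) hf.aemeasurable
  have := Measure.isProbabilityMeasure_map (μ := P) hg.aemeasurable
  calc P {ω | (f ω, g ω) ∈ S} = P.map (fun ω => (f ω, g ω)) S := by
        rw [Measure.map_apply (hf.prodMk hg) hS]
        rfl
    _ = ∫⁻ x, P.map g (Prod.mk x ⁻¹' S) ∂(P.map f) := by
        rw [hfg.map_prod_eq_prod_map_map hf.aemeasurable hg.aemeasurable, Measure.prod_apply hS]
    _ ≤ ∫⁻ _, c ∂(P.map f) := by
        refine lintegral_mono fun x => ?_
        rw [Measure.map_apply hg (measurable_prodMk_left hS)]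
        exact hc x
    _ = c := by simp

/-- The level scales with `‖X u‖`, so the tail bound for frozen `X` does not depend on `X`. -/
theorem measure_lt_mulVec_dotProduct_mulVec_le (hσ : 0 < σ) (ht : 0 ≤ t)
    {X : Ω → Matrix (Fin n) (Fin p) ℝ} (hX : ∀ i j, Measurable fun ω => X ω i j)
    (hE : ∀ i j, Measurable fun ω => E ω i j)
    (hlaw : ∀ i j, P.map (fun ω => E ω i j) = gaussianReal 0 (σ ^ 2).toNNReal)
    (hindep : iIndepFun (fun (ij : Fin n × Fin q) (ω : Ω) => E ω ij.1 ij.2) P)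
    (hXE : IndepFun (fun ω (ij : Fin n × Fin p) => X ω ij.1 ij.2)
      (fun ω (ij : Fin n × Fin q) => E ω ij.1 ij.2) P)
    (u : Fin p → ℝ) (v : Fin q → ℝ) (hv : v ⬝ᵥ v ≤ 1) :
    P {ω | σ * t * √((X ω).mulVec u ⬝ᵥ (X ω).mulVec u) < (X ω).mulVec u ⬝ᵥ (E ω).mulVec v} ≤
      ENNReal.ofReal (Real.exp (-t ^ 2 / 2)) := by
  let S : Set ((Fin n × Fin p → ℝ) × (Fin n × Fin q → ℝ)) :=
    {z | σ * t * √((Matrix.of fun i j => z.1 (i, j)).mulVec u ⬝ᵥ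
        (Matrix.of fun i j => z.1 (i, j)).mulVec u) <
      (Matrix.of fun i j => z.1 (i, j)).mulVec u ⬝ᵥ (Matrix.of fun i j => z.2 (i, j)).mulVec v}
  have hS : MeasurableSet S := by
    apply measurableSet_lt
    · simp only [dotProduct, mulVec, Matrix.of_apply]
      fun_prop
    · simp only [dotProduct, mulVec, Matrix.of_apply]
      fun_prop
  have hfix : ∀ x : Fin n × Fin p → ℝ,
      P {ω | (x, fun ij : Fin n × Fin q => E ω ij.1 ij.2) ∈ S} ≤
        ENNReal.ofReal (Real.exp (-t ^ 2 / 2)) := fun x =>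
    measure_lt_dotProduct_mulVec_le hσ ht hlaw hindep
      ((Matrix.of fun i j => x (i, j)).mulVec u) v hv
  have hfm : Measurable fun ω (ij : Fin n × Fin p) => X ω ij.1 ij.2 :=
    measurable_pi_lambda _ fun ij => hX ij.1 ij.2
  have hgm : Measurable fun ω (ij : Fin n × Fin q) => E ω ij.1 ij.2 :=
    measurable_pi_lambda _ fun ij => hE ij.1 ij.2
  exact hXE.measure_mem_le hfm hgm hS hfix

end Gaussian

/-! ### Uniform noise bound, constants and conclusion. -/

namespace NuclearThreshold

open Matrix

variable {n p q : ℕ}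

/-- The bilinear form `(u, v) ↦ ⟨X u, N v⟩`. -/
noncomputable def crossForm (X : Matrix (Fin n) (Fin p) ℝ) (N : Matrix (Fin n) (Fin q) ℝ) :
    EuclideanSpace ℝ (Fin p) →ₗ[ℝ] EuclideanSpace ℝ (Fin q) →ₗ[ℝ] ℝ :=
  LinearMap.mk₂ ℝ (fun u v => X.mulVec u.ofLp ⬝ᵥ N.mulVec v.ofLp)
    (fun u u' v => by simp [mulVec_add, add_dotProduct])
    (fun c u v => by simp [mulVec_smul])
    (fun u v v' => by simp [mulVec_add, dotProduct_add])
    (fun c u v => by simp [mulVec_smul])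

theorem nine_pow_mul_exp_le {D : ℕ} (hD : 2 ≤ D) {δ : ℝ} (hδ : 0 < δ) :
    (9 : ℝ) ^ D * Real.exp (-(5 / 2 * (√D + √(Real.log (1 / (2 * δ)) / 2))) ^ 2 / 2) ≤ δ := by
  set L := Real.log (1 / (2 * δ)) with hL
  have h9 : (9 : ℝ) ≤ Real.exp (5 / 2) := by
    have h : (9 : ℝ) ^ 2 ≤ Real.exp (5 / 2) ^ 2 := by
      rw [← Real.exp_nat_mul]
      have h1 := Real.exp_one_gt_d9
      have h2 : Real.exp ((2 : ℕ) * (5 / 2)) = Real.exp 1 ^ 5 := by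
        rw [← Real.exp_nat_mul]
        norm_num
      rw [h2]
      refine le_trans ?_ (pow_le_pow_left₀ (by norm_num) h1.le 5)
      norm_num
    exact (pow_le_pow_iff_left₀ (by norm_num) (Real.exp_pos _).le two_ne_zero).1 h
  -- For `δ > 1/2` the root is zero and `L` negative; this inequality still holds and suffices.
  have hy : L / 2 ≤ √(L / 2) ^ 2 := by
    rcases le_total 0 (L / 2) with h | h
    · rw [Real.sq_sqrt h]
    · exact h.trans (sq_nonneg _)
  have hD' : (2 : ℝ) ≤ D := by exact_mod_cast hD
  have hsq : (√(D : ℝ)) ^ 2 = D := Real.sq_sqrt (by positivity)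
  have hcross : 0 ≤ √(D : ℝ) * √(L / 2) := by positivity
  have hexp : Real.exp (-L) = 2 * δ := by
    rw [hL, one_div, Real.log_inv, neg_neg, Real.exp_log (by positivity)]
  have hexp1 : 2 ≤ Real.exp 1 := by linarith [Real.exp_one_gt_d9]
  calc (9 : ℝ) ^ D * Real.exp (-(5 / 2 * (√D + √(L / 2))) ^ 2 / 2)
      ≤ Real.exp (5 / 2) ^ D * Real.exp (-(5 / 2 * (√D + √(L / 2))) ^ 2 / 2) := by gcongr
    _ = Real.exp (D * (5 / 2) + -(5 / 2 * (√D + √(L / 2))) ^ 2 / 2) := by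
        rw [← Real.exp_nat_mul, ← Real.exp_add]
    _ ≤ Real.exp (-1 + -L) := by
        refine Real.exp_le_exp.2 ?_
        -- Half the square is at least `(25/8)(D + √(L/2)²)`. Since `D ≥ 2`, `(25/8 - 5/2) D ≥ 5/4`
        -- pays for `1`, and `(25/8) √(L/2)² ≥ L`.
        nlinarith [sq_nonneg (√(L / 2))]
    _ ≤ δ := by
        rw [Real.exp_add, hexp, Real.exp_neg, inv_mul_le_iff₀ (Real.exp_pos 1)]
        nlinarith

/-- Uniform deviation bound for the form `(u, v) ↦ ⟨X u, E v⟩` with Gaussian noise `E`. -/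
theorem measure_exists_lt_dotProduct_le {Ω : Type*} [MeasurableSpace Ω] (P : Measure Ω)
    [IsProbabilityMeasure P] (hp : 0 < p) (hq : 0 < q) {σ δ : ℝ} (hσ : 0 < σ) (hδ : 0 < δ)
    {X : Ω → Matrix (Fin n) (Fin p) ℝ} {E : Ω → Matrix (Fin n) (Fin q) ℝ}
    (hX : ∀ i j, Measurable fun ω => X ω i j) (hE : ∀ i j, Measurable fun ω => E ω i j)
    (hlaw : ∀ i j, P.map (fun ω => E ω i j) = gaussianReal 0 (σ ^ 2).toNNReal)
    (hindep : iIndepFun (fun (ij : Fin n × Fin q) (ω : Ω) => E ω ij.1 ij.2) P)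
    (hXE : IndepFun (fun ω (ij : Fin n × Fin p) => X ω ij.1 ij.2)
      (fun ω (ij : Fin n × Fin q) => E ω ij.1 ij.2) P) :
    P {ω | ¬ ∀ K : ℝ, (∀ u : EuclideanSpace ℝ (Fin p), ‖u‖ ≤ 1 →
        σ * (5 / 2 * (√((p : ℝ) + q) + √(Real.log (1 / (2 * δ)) / 2))) *
          √((X ω).mulVec u.ofLp ⬝ᵥ (X ω).mulVec u.ofLp) ≤ K) →
        ∀ (u : EuclideanSpace ℝ (Fin p)) (v : EuclideanSpace ℝ (Fin q)),
          (X ω).mulVec u.ofLp ⬝ᵥ (E ω).mulVec v.ofLp ≤ 2 * K * (‖u‖ * ‖v‖)} ≤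
      ENNReal.ofReal δ := by
  set t := 5 / 2 * (√((p : ℝ) + q) + √(Real.log (1 / (2 * δ)) / 2)) with ht
  have ht0 : 0 ≤ t := by positivity
  obtain ⟨s, hscard, hs1, hs⟩ := exists_net_closedBall (EuclideanSpace ℝ (Fin p))
  obtain ⟨r, hrcard, hr1, hr⟩ := exists_net_closedBall (EuclideanSpace ℝ (Fin q))
  set bad : EuclideanSpace ℝ (Fin p) × EuclideanSpace ℝ (Fin q) → Set Ω := fun z =>
    {ω | σ * t * √((X ω).mulVec z.1.ofLp ⬝ᵥ (X ω).mulVec z.1.ofLp) <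
      (X ω).mulVec z.1.ofLp ⬝ᵥ (E ω).mulVec z.2.ofLp} with hbad
  -- The bound `K` is quantified inside the event, so it may depend on `X ω`; the finite union over
  -- net pairs does not involve it.
  have hsub : {ω | ¬ ∀ K : ℝ, (∀ u : EuclideanSpace ℝ (Fin p), ‖u‖ ≤ 1 →
        σ * t * √((X ω).mulVec u.ofLp ⬝ᵥ (X ω).mulVec u.ofLp) ≤ K) →
        ∀ (u : EuclideanSpace ℝ (Fin p)) (v : EuclideanSpace ℝ (Fin q)),
          (X ω).mulVec u.ofLp ⬝ᵥ (E ω).mulVec v.ofLp ≤ 2 * K * (‖u‖ * ‖v‖)} ⊆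
      ⋃ z ∈ s ×ˢ r, bad z := by
    intro ω hω
    by_contra hgood
    refine hω fun K hK u v => ?_
    refine (crossForm (X ω) (E ω)).apply_le_of_net ?_ (s : Set _) (r : Set _) hs hs1 hr ?_ u v
    · change Continuous fun x : EuclideanSpace ℝ (Fin p) × EuclideanSpace ℝ (Fin q) =>
        (X ω).mulVec x.1.ofLp ⬝ᵥ (E ω).mulVec x.2.ofLp
      simp only [dotProduct, mulVec]
      fun_prop
    · intro c hc d hd
      refine le_trans ?_ (hK c (hs1 c hc))
      by_contra! hlt
      exact hgood (Set.mem_biUnion (Finset.mk_mem_product hc hd) hlt)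
  have hone : ∀ z ∈ s ×ˢ r, P (bad z) ≤ ENNReal.ofReal (Real.exp (-t ^ 2 / 2)) := by
    intro z hz
    refine measure_lt_mulVec_dotProduct_mulVec_le hσ ht0 hX hE hlaw hindep hXE _ _ ?_
    have h1 := pow_le_one₀ (n := 2) (norm_nonneg _) (hr1 z.2 (Finset.mem_product.1 hz).2)
    rw [EuclideanSpace.real_norm_sq_eq] at h1
    simpa [dotProduct, sq] using h1
  have hcard : ((s ×ˢ r).card : ℝ) ≤ 9 ^ (p + q) := by
    rw [finrank_euclideanSpace_fin] at hscard hrcard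
    rw [Finset.card_product, pow_add]
    exact_mod_cast Nat.mul_le_mul hscard hrcard
  calc _ ≤ P (⋃ z ∈ s ×ˢ r, bad z) := measure_mono hsub
    _ ≤ ∑ z ∈ s ×ˢ r, P (bad z) := measure_biUnion_finset_le _ _
    _ ≤ ∑ _z ∈ s ×ˢ r, ENNReal.ofReal (Real.exp (-t ^ 2 / 2)) := Finset.sum_le_sum hone
    _ = ENNReal.ofReal ((s ×ˢ r).card * Real.exp (-t ^ 2 / 2)) := by
        rw [Finset.sum_const, nsmul_eq_mul, ENNReal.ofReal_mul (Nat.cast_nonneg _),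
          ENNReal.ofReal_natCast]
    _ ≤ ENNReal.ofReal δ := by
        refine ENNReal.ofReal_le_ofReal ?_
        have h := nine_pow_mul_exp_le (D := p + q) (by omega) hδ
        rw [Nat.cast_add, ← ht] at h
        exact (mul_le_mul_of_nonneg_right hcard (Real.exp_pos _).le).trans h

theorem mul_regParam_eq (hn : 0 < n) (σ δ : ℝ) (X : Matrix (Fin n) (Fin p) ℝ) :
    n * (regParam q σ δ X / 2) =
      2 * (σ * (5 / 2 * (√((p : ℝ) + q) + √(Real.log (1 / (2 * δ)) / 2))) *
        (√n * √(lamMax X))) := by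
  have hsplit : Real.log (1 / (2 * δ)) / (2 * (n : ℝ)) = Real.log (1 / (2 * δ)) / 2 / n := by
    rw [div_div]
  have hn0 : (0 : ℝ) < √n := by positivity
  have hnn : (n : ℝ) = √n * √n := (Real.mul_self_sqrt (Nat.cast_nonneg n)).symm
  rw [regParam, hsplit, Real.sqrt_div' _ (Nat.cast_nonneg n), Real.sqrt_div' _ (Nat.cast_nonneg n)]
  nth_rewrite 1 [hnn]
  field_simp
  ring

theorem thresholdLevel_eq (σ δ : ℝ) (X : Matrix (Fin n) (Fin p) ℝ) :
    thresholdLevel q σ δ X / 2 = regParam q σ δ X / lamMin X := by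
  rw [thresholdLevel, regParam]
  ring

theorem regParam_nonneg {σ : ℝ} (hσ : 0 < σ) (δ : ℝ) (X : Matrix (Fin n) (Fin p) ℝ) :
    0 ≤ regParam q σ δ X := by
  rw [regParam]
  positivity

theorem thresholdLevel_sq_le (hn : 0 < n) {σ δ : ℝ} (hδ₀ : 0 < δ) (hδ₁ : δ < 1)
    {X : Matrix (Fin n) (Fin p) ℝ} (hX : 0 < lamMin X) (hXmax : 0 ≤ lamMax X) :
    thresholdLevel q σ δ X ^ 2 ≤
      800 * (σ ^ 2 * condNum X *
        (((p : ℝ) + (q : ℝ) + Real.log (1 / δ)) / ((n : ℝ) * lamMin X))) := by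
  have hlog : 0 ≤ Real.log (1 / δ) := Real.log_nonneg (by rw [le_div_iff₀ hδ₀]; linarith)
  have hn' : (0 : ℝ) < n := by exact_mod_cast hn
  set a := √(((p : ℝ) + (q : ℝ)) / (n : ℝ)) with ha
  set b := √(Real.log (1 / (2 * δ)) / (2 * (n : ℝ))) with hb
  have ha2 : a ^ 2 = ((p : ℝ) + q) / n := Real.sq_sqrt (by positivity)
  have hb2 : b ^ 2 ≤ Real.log (1 / δ) / n := by
    have hle : b ≤ √(Real.log (1 / δ) / n) := by
      refine Real.sqrt_le_sqrt ?_
      have h1 : Real.log (1 / (2 * δ)) ≤ Real.log (1 / δ) := by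
        refine Real.log_le_log (by positivity) ?_
        gcongr
        linarith
      calc Real.log (1 / (2 * δ)) / (2 * n) ≤ Real.log (1 / δ) / (2 * n) := by gcongr
        _ ≤ Real.log (1 / δ) / n := by
          gcongr
          linarith
    exact (pow_le_pow_left₀ (Real.sqrt_nonneg _) hle 2).trans_eq (Real.sq_sqrt (by positivity))
  -- This factor 2 and the `400 = 20²` from the threshold level give the constant 800.
  have hab : (a + b) ^ 2 ≤ 2 * (((p : ℝ) + q + Real.log (1 / δ)) / n) := by
    rw [add_div, ← ha2]
    nlinarith [sq_nonneg (a - b)]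
  have heq : thresholdLevel q σ δ X ^ 2 = 400 * σ ^ 2 * lamMax X / lamMin X ^ 2 * (a + b) ^ 2 := by
    rw [thresholdLevel, ← ha, ← hb, div_pow, mul_pow, mul_pow, mul_pow, Real.sq_sqrt hXmax]
    ring
  rw [heq]
  refine (mul_le_mul_of_nonneg_left hab (by positivity)).trans_eq ?_
  rw [condNum]
  field_simp
  ring

theorem frobSq_threshold_sub_le_oracleRisk (hn : 0 < n) (hp : 0 < p) {σ δ : ℝ} (hσ : 0 < σ)
    (hδ₀ : 0 < δ) (hδ₁ : δ < 1) (r : ℕ) {X : Matrix (Fin n) (Fin p) ℝ} (hX : 0 < lamMin X)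
    {A M : Matrix (Fin q) (Fin p) ℝ} {N : Matrix (Fin n) (Fin q) ℝ}
    (hM : IsNuclearNormEstimator (regParam q σ δ X) X (X * A.transpose + N) M)
    (hN : ∀ (u : EuclideanSpace ℝ (Fin p)) (v : EuclideanSpace ℝ (Fin q)),
      X.mulVec u.ofLp ⬝ᵥ N.mulVec v.ofLp ≤ n * (regParam q σ δ X / 2) * (‖u‖ * ‖v‖)) :
    frobSq (threshold (thresholdLevel q σ δ X) M - A) ≤ 2000 * oracleRisk r σ δ X A := by
  have hmax : 0 < lamMax X := hX.trans_le (lamMin_le_lamMax hp X)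
  have hμ := regParam_nonneg (q := q) hσ δ X
  have hop := hM.norm_sub_le hn hμ hX fun u v => by
    have h := hN u (-v)
    rwa [WithLp.ofLp_neg, mulVec_neg, dotProduct_neg, norm_neg] at h
  rw [← thresholdLevel_eq] at hop
  have hξ : 0 ≤ thresholdLevel q σ δ X := by
    have h := div_nonneg hμ hX.le
    rw [← thresholdLevel_eq] at h
    linarith
  obtain ⟨k, -, hk⟩ := Finset.exists_mem_eq_inf' (Finset.nonempty_range_add_one (n := r))
    fun k : ℕ => (k : ℝ) * σ ^ 2 * condNum X *
        (((p : ℝ) + (q : ℝ) + Real.log (1 / δ)) / ((n : ℝ) * lamMin X)) +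
      ∑ i ∈ Finset.Ico k (min q p), sv A i ^ 2
  rw [oracleRisk, hk]
  have h1 := frobSq_threshold_sub_le M A hξ hop k
  have h2 := mul_le_mul_of_nonneg_left (thresholdLevel_sq_le (q := q) (σ := σ) hn hδ₀ hδ₁ hX hmax.le)
    (Nat.cast_nonneg (α := ℝ) k)
  -- The constant is `2000 = (5/2) · 800`; nonnegativity of the tail lets its factor `5/2` grow to
  -- 2000.
  have h3 : 0 ≤ ∑ i ∈ Finset.Ico k (min q p), sv A i ^ 2 :=
    Finset.sum_nonneg fun i _ => sq_nonneg _
  linarith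

end NuclearThreshold

theorem mainTheorem12 :
    ∃ C : ℝ, 0 < C ∧
      ∀ {Ω : Type*} [MeasurableSpace Ω] (P : Measure Ω) [IsProbabilityMeasure P]
        (n dx dy r : ℕ) (_hn : 0 < n) (_hdx : 0 < dx) (_hdy : 0 < dy)
        (σ δ : ℝ) (_hσ : 0 < σ) (_hδ₀ : 0 < δ) (_hδ₁ : δ < 1)
        (A : Matrix (Fin dy) (Fin dx) ℝ) (_hA : A.rank ≤ r)
        (X : Ω → Matrix (Fin n) (Fin dx) ℝ) (E : Ω → Matrix (Fin n) (Fin dy) ℝ)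
        (_hX : ∀ i j, Measurable (fun ω => X ω i j))
        (_hE : ∀ i j, Measurable (fun ω => E ω i j))
        (_hElaw : ∀ i j, P.map (fun ω => E ω i j) = gaussianReal 0 (σ ^ 2).toNNReal)
        (_hEindep : iIndepFun (fun (ij : Fin n × Fin dy) (ω : Ω) => E ω ij.1 ij.2) P)
        (_hXE : IndepFun (fun ω (ij : Fin n × Fin dx) => X ω ij.1 ij.2)
          (fun ω (ij : Fin n × Fin dy) => E ω ij.1 ij.2) P)
        (Abar : Ω → Matrix (Fin dy) (Fin dx) ℝ)
        (_hAbar : ∀ᵐ ω ∂P,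
          NuclearThreshold.IsNuclearNormEstimator (NuclearThreshold.regParam dy σ δ (X ω)) (X ω)
            (X ω * A.transpose + E ω) (Abar ω)),
        P {ω | 0 < NuclearThreshold.lamMin (X ω) ∧
            C * NuclearThreshold.oracleRisk r σ δ (X ω) A <
              NuclearThreshold.frobSq
                (NuclearThreshold.threshold
                    (NuclearThreshold.thresholdLevel dy σ δ (X ω)) (Abar ω) - A)}
          ≤ ENNReal.ofReal δ := by
  refine ⟨2000, by norm_num, ?_⟩
  intro Ω _ P _ n dx dy r hn hdx hdy σ δ hσ hδ₀ hδ₁ A _ X E hX hE hlaw hindep hXE Abar hAbar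
  refine (measure_mono_ae ?_).trans
    (NuclearThreshold.measure_exists_lt_dotProduct_le P hdx hdy hσ hδ₀ hX hE hlaw hindep hXE)
  filter_upwards [hAbar] with ω hω hbad hgood
  refine not_le.2 hbad.2 (NuclearThreshold.frobSq_threshold_sub_le_oracleRisk hn hdx hσ hδ₀ hδ₁ r
    hbad.1 hω ?_)
  rw [NuclearThreshold.mul_regParam_eq hn]
  -- Here `K` is `σ t √n √λ_max`, with `t` the deviation level of the uniform bound; it dominates `σ
  -- t ‖X u‖` on the unit ball.
  refine hgood _ fun u hu => ?_
  have hmax := hbad.1.le.trans (NuclearThreshold.lamMin_le_lamMax hdx (X ω))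
  rw [← Real.sqrt_mul (Nat.cast_nonneg n)]
  gcongr
  refine (NuclearThreshold.le_lamMax_mul hn (X ω) u).trans ?_
  gcongr
  exact mul_le_of_le_one_right hmax (pow_le_one₀ (norm_nonneg _) hu)
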